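/- A \emph{marked group} with $k$ generators is a pair $(G,S)$, where $G$ is a group and $S=(s_1,\dots,s_k)$ is an ordered generating set of $G$ consisting of $k$ distinct elements with $S=S^{-1}$. A surjection of marked groups $(G,S)\to(G',S')$ is a surjective group homomorphism $G\to G'$ that maps $s_i$ to $s'_i$ for $1\le i\le k$. Marked groups with $k$ generators carry the Chabauty topology, in which a basis of neighborhoods of $(G,S)$ is given by the sets, for $n\in\mathbb N$, of all $(G',S')$ such that the kernels of the canonical epimorphisms $F_k\to G$ and $F_k\to G'$ coincide inside the ball of radius $n$ of the free group $F_k$. \medskip \noindent\textbf{Lemma (main construction).} There exists a family $\{(G_J,S_J) : J\subseteq\mathbb N\}$ of marked groups with $4$ generators such that: \begin{itemize} \item (strict monotonicity) for all subsets $J\subsetneq J'$ of $\mathbb N$ there is a surjection of marked groups $(G_{J'},S_{J'})\to(G_J,S_J)$ whose kernel is nonamenable; \item (continuity) the map $J\mapsto(G_J,S_J)$ is continuous from $2^{\mathbb N}$ with the Tychonoff (product) topology to the space of marked groups with the Chabauty topology; that is, if $J_n\to J$ in $2^{\mathbb N}$, then $(G_{J_n},S_{J_n})\to(G_J,S_J)$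 in the Chabauty topology. \end{itemize} -/

import Mathlib

/-- A marked group with `k` generators: a group together with an ordered symmetric
generating set `s 0, …, s (k - 1)` of size `k`. -/
structure MarkedGroup (k : ℕ) where
  carrier : Type
  [group : Group carrier]
  /-- the ordered generators -/
  gen : Fin k → carrier
  /-- the generating set has exactly `k` elements -/
  gen_injective : Function.Injective gen
  /-- the generating set is closed under inverses -/
  gen_symm : ∀ i, ∃ j, (gen i)⁻¹ = gen j
  /-- the generators generate the group -/
  gen_closure : Subgroup.closure (Set.range gen) = ⊤

namespace MarkedGroup

attribute [instance] MarkedGroup.group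

variable {k : ℕ}

/-- The canonical epimorphism from the free group on `k` letters to a marked group. -/
def ofFree (G : MarkedGroup k) : FreeGroup (Fin k) →* G.carrier :=
  FreeGroup.lift G.gen

/-- Two marked groups have the same relations of length at most `n`: the kernels of the
canonical epimorphisms from the free group coincide inside the ball of radius `n`. -/
def SameRelations (n : ℕ) (G H : MarkedGroup k) : Prop :=
  ∀ w : FreeGroup (Fin k), w.norm ≤ n → (w ∈ G.ofFree.ker ↔ w ∈ H.ofFree.ker)

/-- The Chabauty topology on marked groups: a set `U` is open if with every `G` it contains, for
some `n`, all the marked groups that have the same relations of length at most `n` as `G`. -/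
instance chabautyTopology : TopologicalSpace (MarkedGroup k) where
  IsOpen U := ∀ G ∈ U, ∃ n, ∀ H, SameRelations n G H → H ∈ U
  isOpen_univ := fun _ _ => ⟨0, fun _ _ => trivial⟩
  isOpen_inter := by
    rintro U V hU hV G ⟨hGU, hGV⟩
    obtain ⟨m, hm⟩ := hU G hGU
    obtain ⟨n, hn⟩ := hV G hGV
    exact ⟨max m n, fun H h =>
      ⟨hm H fun w hw => h w (hw.trans (le_max_left m n)),
        hn H fun w hw => h w (hw.trans (le_max_right m n))⟩⟩
  isOpen_sUnion := by
    rintro S hS G ⟨U, hU, hG⟩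
    obtain ⟨n, hn⟩ := hS U hU G hG
    exact ⟨n, fun H h => ⟨U, hU, hn H h⟩⟩

/-- A homomorphism of marked groups: a group homomorphism that maps the `i`-th generator to the
`i`-th generator. -/
def IsMarkedHom (G H : MarkedGroup k) (φ : G.carrier →* H.carrier) : Prop :=
  ∀ i, φ (G.gen i) = H.gen i

end MarkedGroup

/-- Amenability of a discrete group: there is a left-invariant finitely additive probability
measure defined on all subsets of the group. -/
def IsAmenableGroup (G : Type) [Group G] : Prop :=
  ∃ m : Set G → ℝ,
    (∀ A, 0 ≤ m A) ∧ m Set.univ = 1 ∧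
    (∀ A B, Disjoint A B → m (A ∪ B) = m A + m B) ∧
    (∀ (g : G) (A : Set G), m ((fun x => g * x) '' A) = m A)

/-! Let `ShiftArtin J` be generated by x_i, i ∈ ℤ, where x_i and x_j (i ≠ j) commute unless |i - j|
- 1 ∈ J. Translations act on it, and the semidirect product with ℤ is generated by a = x_0 and the
translation t. Enlarging J removes relations, hence the surjections. If n ∈ J' \ J, the kernel
contains ⁅x_0, x_{n+1}⁆ and ⁅x_0⁻¹, x_{n+1}⁻¹⁆; killing the other generators sends these to
commutators in a free group, where ping-pong on first letters excludes amenability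
(`not_isAmenableGroup_of_commutator_mem_range`). Continuity holds because a word involves finitely
many x_i, so only bounded gaps matter (`exists_mk_eq_one_iff`). -/

open scoped commutatorElement

/-! ### Amenability and first letters in the free group -/

namespace FreeGroup

variable {α : Type*} [DecidableEq α]

/-- No cancellation occurs: `w` does not start with the letter `(c, d)`, and from then on each
letter multiplied on the left meets one of the other generator. -/
theorem commutator_mul_mem_startsWith {a c : α} (hac : a ≠ c) (b d : Bool) {w : FreeGroup α}
    (hw : w ∉ startsWith (c, d)) :
    ⁅mk [(a, b)], mk [(c, d)]⁆ * w ∈ startsWith (a, b) := by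
  have not_mem {l l' : α × Bool} (h : l ≠ l') {v : FreeGroup α} (hv : v ∈ startsWith l) :
      v ∉ startsWith l' := Set.disjoint_left.1 (startsWith.disjoint_iff_ne.2 h) hv
  have h₁ : mk [(c, !d)] * w ∈ startsWith (c, !d) :=
    startsWith_mk_mul w (by simpa using hw)
  have h₂ := startsWith_mk_mul (w := (a, !b)) _ (not_mem (l' := (a, !!b)) (by simp [hac.symm]) h₁)
  have h₃ := startsWith_mk_mul (w := (c, d)) _ (not_mem (l' := (c, !d)) (by simp [hac]) h₂)
  have h₄ := startsWith_mk_mul (w := (a, b)) _ (not_mem (l' := (a, !b)) (by simp [hac.symm]) h₃)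
  simpa [commutatorElement_def, inv_mk, invRev, mul_assoc, -mul_mk] using h₄

end FreeGroup

/-- A group that maps to a free group so that `⁅x, y⁆` and `⁅x⁻¹, y⁻¹⁆` are in the image, for two
letters `x ≠ y`, is not amenable. -/
theorem not_isAmenableGroup_of_commutator_mem_range {K : Type} [Group K] {α : Type*}
    {a c : α} (hac : a ≠ c) (f : K →* FreeGroup α)
    (hp : ⁅FreeGroup.of a, FreeGroup.of c⁆ ∈ f.range)
    (hq : ⁅(FreeGroup.of a)⁻¹, (FreeGroup.of c)⁻¹⁆ ∈ f.range) : ¬ IsAmenableGroup K := by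
  classical
  rintro ⟨m, hnonneg, huniv, hadd, hinv⟩
  have mono {A B : Set K} (h : A ⊆ B) : m A ≤ m B := by
    rw [← Set.union_sdiff_cancel h, hadd _ _ Set.disjoint_sdiff_right]
    linarith [hnonneg (B \ A)]
  have key (b : Bool) (h : ⁅FreeGroup.mk [(a, b)], FreeGroup.mk [(c, b)]⁆ ∈ f.range) :
      1 ≤ m (f ⁻¹' FreeGroup.startsWith (a, b)) + m (f ⁻¹' FreeGroup.startsWith (c, b)) := by
    obtain ⟨p, hp⟩ := h
    set T := f ⁻¹' FreeGroup.startsWith (c, b)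
    have hsub : (fun x => p * x) '' Tᶜ ⊆ f ⁻¹' FreeGroup.startsWith (a, b) := by
      rintro _ ⟨x, hx, rfl⟩
      rw [Set.mem_preimage, map_mul, hp]
      exact FreeGroup.commutator_mul_mem_startsWith hac b b hx
    have h₁ := mono hsub
    rw [hinv] at h₁
    have h₂ := hadd T Tᶜ disjoint_compl_right
    rw [Set.union_compl_self, huniv] at h₂
    linarith
  have disj {l l' : α × Bool} (h : l ≠ l') :
      Disjoint (f ⁻¹' FreeGroup.startsWith l) (f ⁻¹' FreeGroup.startsWith l') :=
    (FreeGroup.startsWith.disjoint_iff_ne.2 h).preimage f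
  -- The four preimages are disjoint, yet their total mass is at least 2.
  have h₁ := key true hp
  have h₂ := key false hq
  rw [← hadd _ _ (disj (by simp [hac]))] at h₁ h₂
  have h₃ := hadd (f ⁻¹' FreeGroup.startsWith (a, true) ∪ f ⁻¹' FreeGroup.startsWith (c, true))
    (f ⁻¹' FreeGroup.startsWith (a, false) ∪ f ⁻¹' FreeGroup.startsWith (c, false)) (by
      simp only [Set.disjoint_union_left, Set.disjoint_union_right]
      exact ⟨⟨disj (by simp), disj (by simp)⟩, disj (by simp), disj (by simp)⟩)
  linarith [mono (Set.subset_univ (f ⁻¹' FreeGroup.startsWith (a, true) ∪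
    f ⁻¹' FreeGroup.startsWith (c, true) ∪ (f ⁻¹' FreeGroup.startsWith (a, false) ∪
      f ⁻¹' FreeGroup.startsWith (c, false))))]

/-! ### Shift-invariant right-angled Artin groups on `ℤ` -/

/-- The relations of `ShiftArtin J`. -/
def shiftArtinRels (J : Set ℕ) : Set (FreeGroup ℤ) :=
  {r | ∃ (i : ℤ) (n : ℕ), n ∉ J ∧ r = ⁅FreeGroup.of i, FreeGroup.of (i + (n + 1))⁆}

/-- The right-angled Artin group with generators indexed by `ℤ`, in which the generators `i` and
`i + n + 1` commute for `n ∉ J`. -/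
abbrev ShiftArtin (J : Set ℕ) : Type := PresentedGroup (shiftArtinRels J)

namespace ShiftArtin

variable {J J' : Set ℕ}

/-- The generators of `ShiftArtin J`. -/
def of (J : Set ℕ) (i : ℤ) : ShiftArtin J := PresentedGroup.of i

theorem commutator_of (i : ℤ) {n : ℕ} (hn : n ∉ J) : ⁅of J i, of J (i + (n + 1))⁆ = 1 :=
  PresentedGroup.one_of_mem ⟨i, n, hn, rfl⟩

/-- The universal property of `ShiftArtin J`. -/
def lift {H : Type*} [Group H] (f : ℤ → H)
    (hf : ∀ (i : ℤ) (n : ℕ), n ∉ J → ⁅f i, f (i + (n + 1))⁆ = 1) : ShiftArtin J →* H :=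
  PresentedGroup.toGroup (f := f) (by
    rintro _ ⟨i, n, hn, rfl⟩
    simpa [map_commutatorElement] using hf i n hn)

@[simp]
theorem lift_of {H : Type*} [Group H] (f : ℤ → H)
    (hf : ∀ (i : ℤ) (n : ℕ), n ∉ J → ⁅f i, f (i + (n + 1))⁆ = 1) (i : ℤ) :
    lift f hf (of J i) = f i :=
  PresentedGroup.toGroup.of _

theorem hom_ext {H : Type*} [Group H] {f g : ShiftArtin J →* H}
    (h : ∀ i, f (of J i) = g (of J i)) : f = g :=
  PresentedGroup.ext h

theorem mk_of (i : ℤ) : PresentedGroup.mk (shiftArtinRels J) (FreeGroup.of i) = of J i := rfl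

/-- The translation by `k`. -/
def shift (J : Set ℕ) (k : ℤ) : ShiftArtin J →* ShiftArtin J :=
  lift (fun i => of J (k + i)) fun i n hn => by
    rw [← add_assoc]
    exact commutator_of _ hn

@[simp]
theorem shift_of (k i : ℤ) : shift J k (of J i) = of J (k + i) := lift_of _ _ i

/-- `ℤ` acts on `ShiftArtin J` by translations. -/
instance : MulDistribMulAction (Multiplicative ℤ) (ShiftArtin J) where
  smul k b := shift J k.toAdd b
  one_smul b := by
    have : shift J 0 = MonoidHom.id _ := hom_ext fun i => by simp
    exact DFunLike.congr_fun this b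
  mul_smul k l b := by
    have : shift J (k.toAdd + l.toAdd) = (shift J k.toAdd).comp (shift J l.toAdd) :=
      hom_ext fun i => by simp [add_assoc]
    exact DFunLike.congr_fun this b
  smul_mul k := map_mul (shift J k.toAdd)
  smul_one k := map_one (shift J k.toAdd)

theorem smul_of (k : Multiplicative ℤ) (i : ℤ) : k • of J i = of J (k.toAdd + i) :=
  shift_of _ i

/-- The canonical map between two of the groups, for `J ⊆ J'`. -/
def map (h : J ⊆ J') : ShiftArtin J' →* ShiftArtin J :=
  lift (of J) fun i _ hn => commutator_of i fun hJ => hn (h hJ)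

@[simp]
theorem map_of (h : J ⊆ J') (i : ℤ) : map h (of J' i) = of J i := lift_of _ _ i

theorem map_mk (h : J ⊆ J') (u : FreeGroup ℤ) :
    map h (PresentedGroup.mk _ u) = PresentedGroup.mk _ u := by
  have : (map h).comp (PresentedGroup.mk _) = PresentedGroup.mk _ :=
    FreeGroup.ext_hom _ _ fun i => map_of h i
  exact DFunLike.congr_fun this u

theorem map_smul (h : J ⊆ J') (k : Multiplicative ℤ) (b : ShiftArtin J') :
    map h (k • b) = k • map h b := by
  have : (map h).comp (MulDistribMulAction.toMonoidHom _ k) =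
      (MulDistribMulAction.toMonoidHom _ k).comp (map h) :=
    hom_ext fun i => by simp [smul_of]
  exact DFunLike.congr_fun this b

theorem map_surjective (h : J ⊆ J') : Function.Surjective (map h) := fun b => by
  obtain ⟨u, rfl⟩ := PresentedGroup.mk_surjective _ b
  exact ⟨_, map_mk h u⟩

/-- An element of a free group on `ℤ` involves only letters from a bounded window. -/
theorem exists_window (u : FreeGroup ℤ) : ∃ M : ℕ, ∀ M' ≥ M,
    FreeGroup.lift (fun i : ℤ => if i.natAbs ≤ M' then FreeGroup.of i else 1) u = u := by
  induction u using FreeGroup.induction_on with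
  | C1 => exact ⟨0, fun _ _ => map_one _⟩
  | of i => exact ⟨i.natAbs, fun M' h => by simp [h.le]⟩
  | inv_of i ih =>
    obtain ⟨M, hM⟩ := ih
    exact ⟨M, fun M' h => by rw [map_inv, hM M' h]⟩
  | mul u v hu hv =>
    obtain ⟨M, hM⟩ := hu
    obtain ⟨N, hN⟩ := hv
    exact ⟨max M N, fun M' h => by
      rw [map_mul, hM M' (le_of_max_le_left h), hN M' (le_of_max_le_right h)]⟩

/-- Whether a word is trivial in `ShiftArtin J` depends only on a finite part of `J`. -/
theorem exists_mk_eq_one_iff (u : FreeGroup ℤ) : ∃ N : ℕ, ∀ J J' : Set ℕ,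
    (∀ n < N, n ∈ J ↔ n ∈ J') →
      (PresentedGroup.mk (shiftArtinRels J) u = 1 ↔
        PresentedGroup.mk (shiftArtinRels J') u = 1) := by
  obtain ⟨M, hM⟩ := exists_window u
  have key (J J' : Set ℕ) (h : ∀ n < 2 * M, n ∈ J ↔ n ∈ J')
      (hu : PresentedGroup.mk (shiftArtinRels J) u = 1) :
      -- Killing the generators outside [-M, M] fixes `u`. Two indices inside differ by `n + 1 ≤ 2 *
      -- M`, so only `n < 2 * M` matters.
      PresentedGroup.mk (shiftArtinRels J') u = 1 := by
    let ψ : ShiftArtin J →* ShiftArtin J' :=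
      lift (fun i => if i.natAbs ≤ M then of J' i else 1) fun i n hn => by
        by_cases hi : i.natAbs ≤ M
        · by_cases hj : (i + (n + 1)).natAbs ≤ M
          · simp only [hi, hj, if_true]
            exact commutator_of i fun h' => hn ((h n (by omega)).2 h')
          · simp [hj]
        · simp [hi]
    have hψ : ψ.comp (PresentedGroup.mk _) = (PresentedGroup.mk (shiftArtinRels J')).comp
        (FreeGroup.lift fun i : ℤ => if i.natAbs ≤ M then FreeGroup.of i else 1) := by
      refine FreeGroup.ext_hom _ _ fun i => ?_
      rw [MonoidHom.comp_apply, mk_of, lift_of, MonoidHom.comp_apply, FreeGroup.lift_apply_of]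
      split_ifs
      · rfl
      · exact (map_one _).symm
    have h₁ := DFunLike.congr_fun hψ u
    simp only [MonoidHom.comp_apply, hM M le_rfl, hu, map_one] at h₁
    exact h₁.symm
  exact ⟨2 * M, fun J J' h => ⟨key J J' h, key J' J fun n hn => (h n hn).symm⟩⟩

/-- The total exponent. -/
def degree (J : Set ℕ) : ShiftArtin J →* Multiplicative ℤ :=
  lift (fun _ => Multiplicative.ofAdd 1) fun _ _ _ => commutatorElement_self _

theorem of_ne_inv_of (i : ℤ) : of J i ≠ (of J i)⁻¹ := fun h => by
  have := congrArg (fun b => (degree J b).toAdd) h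
  simp [degree] at this

/-- The retraction to the free group on the generators `0` and `n + 1`, for `n ∈ J`. -/
def toFreeGroup {n : ℕ} (hn : n ∈ J) : ShiftArtin J →* FreeGroup ℤ :=
  lift (fun i => if i = 0 ∨ i = n + 1 then FreeGroup.of i else 1) fun i k hk => by
    have hkn : k ≠ n := fun h => hk (h ▸ hn)
    by_cases h : (i = 0 ∨ i = n + 1) ∧ (i + (k + 1) = 0 ∨ i + (k + 1) = n + 1)
    -- Two distinct indices in {0, n + 1} differ by n + 1, which would force k = n.
    · omega
    · rcases not_and_or.1 h with h | h <;> simp [h]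

theorem toFreeGroup_of_zero {n : ℕ} (hn : n ∈ J) :
    toFreeGroup hn (of J 0) = FreeGroup.of 0 := by
  simp [toFreeGroup]

theorem toFreeGroup_of_succ {n : ℕ} (hn : n ∈ J) :
    toFreeGroup hn (of J (n + 1)) = FreeGroup.of (n + 1 : ℤ) := by
  simp [toFreeGroup]

end ShiftArtin

/-! ### The marked groups and the kernels between them -/

/-- The extension of `ShiftArtin J` by the translations. -/
abbrev ShiftArtinExt (J : Set ℕ) : Type :=
  ShiftArtin J ⋊[MulDistribMulAction.toMulAut (Multiplicative ℤ) (ShiftArtin J)] Multiplicative ℤ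

namespace ShiftArtinExt

open SemidirectProduct

variable {J J' : Set ℕ}

/-- The generator from `ShiftArtin J`. -/
def a (J : Set ℕ) : ShiftArtinExt J := inl (ShiftArtin.of J 0)

/-- The translation by one. -/
def t (J : Set ℕ) : ShiftArtinExt J := inr (Multiplicative.ofAdd 1)

/-- The four generators. -/
def gen (J : Set ℕ) : Fin 4 → ShiftArtinExt J := ![a J, (a J)⁻¹, t J, (t J)⁻¹]

theorem gen_injective (J : Set ℕ) : Function.Injective (gen J) := by
  have haa : a J ≠ (a J)⁻¹ := fun h => by
    rw [a, ← map_inv] at h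
    exact ShiftArtin.of_ne_inv_of 0 (inl_injective h)
  have hat : a J ≠ t J := fun h => by
    have := congrArg (fun g => (rightHom g).toAdd) h
    simp [a, t] at this
  have hat' : a J ≠ (t J)⁻¹ := fun h => by
    have := congrArg (fun g => (rightHom g).toAdd) h
    simp [a, t] at this
  have htt : t J ≠ (t J)⁻¹ := fun h => by
    have := congrArg (fun g => (rightHom g).toAdd) h
    simp [t] at this
  have ha't : (a J)⁻¹ ≠ t J := fun h => hat' (inv_eq_iff_eq_inv.1 h)
  have ha't' : (a J)⁻¹ ≠ (t J)⁻¹ := fun h => hat (inv_injective h)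
  intro i j hij
  fin_cases i <;> fin_cases j <;>
    simp_all [gen, haa.symm, hat.symm, hat'.symm, htt.symm, ha't.symm]

theorem inr_eq_t_zpow (k : Multiplicative ℤ) :
    (inr k : ShiftArtinExt J) = t J ^ k.toAdd := by
  rw [t, ← map_zpow, ← ofAdd_zsmul]
  simp

/-- Translation is conjugation by `t`; this is why `a` and `t` suffice to generate. -/
theorem inl_of (i : ℤ) :
    (inl (ShiftArtin.of J i) : ShiftArtinExt J) = t J ^ i * a J * (t J ^ i)⁻¹ := by
  have h := inl_aut (φ := MulDistribMulAction.toMulAut (Multiplicative ℤ) (ShiftArtin J))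
    (Multiplicative.ofAdd i) (ShiftArtin.of J 0)
  rw [MulDistribMulAction.toMulAut_apply, MulDistribMulAction.toMulEquiv_apply,
    ShiftArtin.smul_of, map_inv, inr_eq_t_zpow] at h
  simpa [a] using h

theorem closure_gen (J : Set ℕ) : Subgroup.closure (Set.range (gen J)) = ⊤ := by
  set S := Subgroup.closure (Set.range (gen J))
  have ha : a J ∈ S := Subgroup.subset_closure ⟨0, rfl⟩
  have ht : t J ∈ S := Subgroup.subset_closure ⟨2, rfl⟩
  have hinl (b : ShiftArtin J) : inl b ∈ S := by
    have : Subgroup.closure (Set.range (PresentedGroup.of (rels := shiftArtinRels J))) ≤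
        S.comap inl := by
      rw [Subgroup.closure_le]
      rintro _ ⟨i, rfl⟩
      change inl (ShiftArtin.of J i) ∈ S
      rw [inl_of]
      exact S.mul_mem (S.mul_mem (S.zpow_mem ht i) ha) (S.inv_mem (S.zpow_mem ht i))
    rw [PresentedGroup.closure_range_of] at this
    exact this (Subgroup.mem_top b)
  refine eq_top_iff.2 fun g _ => ?_
  rw [← inl_left_mul_inr_right g, inr_eq_t_zpow]
  exact S.mul_mem (hinl _) (S.zpow_mem ht _)

/-- `ShiftArtinExt J`, marked by its four generators. -/
def marked (J : Set ℕ) : MarkedGroup 4 where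
  carrier := ShiftArtinExt J
  gen := gen J
  gen_injective := gen_injective J
  gen_symm i := by
    fin_cases i
    exacts [⟨1, rfl⟩, ⟨0, inv_inv _⟩, ⟨3, rfl⟩, ⟨2, inv_inv _⟩]
  gen_closure := closure_gen J

/-- The canonical map between two of the groups, for `J ⊆ J'`. -/
def map (h : J ⊆ J') : ShiftArtinExt J' →* ShiftArtinExt J :=
  SemidirectProduct.map (ShiftArtin.map h) (MonoidHom.id _) fun k =>
    MonoidHom.ext fun b => ShiftArtin.map_smul h k b

@[simp]
theorem map_left (h : J ⊆ J') (g : ShiftArtinExt J') : (map h g).left = ShiftArtin.map h g.left :=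
  SemidirectProduct.map_left ..

@[simp]
theorem map_right (h : J ⊆ J') (g : ShiftArtinExt J') : (map h g).right = g.right :=
  SemidirectProduct.map_right ..

theorem map_gen (h : J ⊆ J') (i : Fin 4) : map h (gen J' i) = gen J i := by
  have ha : map h (a J') = a J := by simp [map, a]
  have ht : map h (t J') = t J := by simp [map, t]
  fin_cases i
  · exact ha
  · exact (map_inv _ _).trans (congrArg _ ha)
  · exact ht
  · exact (map_inv _ _).trans (congrArg _ ht)

theorem map_surjective (h : J ⊆ J') : Function.Surjective (map h) := fun g => by
  obtain ⟨b, hb⟩ := ShiftArtin.map_surjective h g.left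
  exact ⟨⟨b, g.right⟩, SemidirectProduct.ext hb rfl⟩

/-- Hence the twist disappears on the kernel, and taking the left component is multiplicative there.
-/
theorem right_eq_one_of_mem_ker (h : J ⊆ J') {g : ShiftArtinExt J'} (hg : g ∈ (map h).ker) :
    g.right = 1 :=
  (map_right h g).symm.trans (congrArg right hg)

/-- The projection of the kernel of `map h` to `ShiftArtin J'`. -/
def kerToArtin (h : J ⊆ J') : (map h).ker →* ShiftArtin J' where
  toFun g := g.1.left
  map_one' := rfl
  map_mul' g g' := by
    simp [mul_left, right_eq_one_of_mem_ker h g.2]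

theorem mem_range_kerToArtin (h : J ⊆ J') {b : ShiftArtin J'} (hb : ShiftArtin.map h b = 1) :
    b ∈ (kerToArtin h).range :=
  ⟨⟨inl b, SemidirectProduct.ext hb rfl⟩, rfl⟩

theorem not_isAmenableGroup_ker_map (h : J ⊂ J') : ¬ IsAmenableGroup (map h.subset).ker := by
  obtain ⟨n, hn', hn⟩ := Set.exists_of_ssubset h
  have hcomm : Commute (ShiftArtin.of J 0) (ShiftArtin.of J (n + 1)) := by
    rw [← commutatorElement_eq_one_iff_commute]
    simpa using ShiftArtin.commutator_of 0 hn
  refine not_isAmenableGroup_of_commutator_mem_range (a := (0 : ℤ)) (c := n + 1) (by omega)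
    ((ShiftArtin.toFreeGroup hn').comp (kerToArtin h.subset)) ?_ ?_
  · obtain ⟨g, hg⟩ := mem_range_kerToArtin h.subset
      (b := ⁅ShiftArtin.of J' 0, ShiftArtin.of J' (n + 1)⁆) (by
        simpa [map_commutatorElement, commutatorElement_eq_one_iff_commute] using hcomm)
    exact ⟨g, by rw [MonoidHom.comp_apply, hg, map_commutatorElement,
      ShiftArtin.toFreeGroup_of_zero, ShiftArtin.toFreeGroup_of_succ]⟩
  · obtain ⟨g, hg⟩ := mem_range_kerToArtin h.subset
      (b := ⁅(ShiftArtin.of J' 0)⁻¹, (ShiftArtin.of J' (n + 1))⁻¹⁆) (by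
        simpa [map_commutatorElement, commutatorElement_eq_one_iff_commute] using hcomm)
    exact ⟨g, by rw [MonoidHom.comp_apply, hg, map_commutatorElement, map_inv, map_inv,
      ShiftArtin.toFreeGroup_of_zero, ShiftArtin.toFreeGroup_of_succ]⟩

/-! ### Dependence of the relations on `J` -/

theorem map_lift_gen (h : J ⊆ J') (w : FreeGroup (Fin 4)) :
    map h (FreeGroup.lift (gen J') w) = FreeGroup.lift (gen J) w := by
  have : (map h).comp (FreeGroup.lift (gen J')) = FreeGroup.lift (gen J) :=
    FreeGroup.ext_hom _ _ fun i => by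
      rw [MonoidHom.comp_apply, FreeGroup.lift_apply_of, FreeGroup.lift_apply_of, map_gen]
  exact DFunLike.congr_fun this w

theorem mem_ker_ofFree_marked (w : FreeGroup (Fin 4)) :
    w ∈ (marked J).ofFree.ker ↔ FreeGroup.lift (gen J) w = 1 :=
  Iff.rfl

/-- Whether a word is a relation of `marked J` depends only on a finite part of `J`. -/
theorem exists_mem_ker_ofFree_iff (w : FreeGroup (Fin 4)) : ∃ N : ℕ, ∀ J J' : Set ℕ,
    (∀ n < N, n ∈ J ↔ n ∈ J') → (w ∈ (marked J).ofFree.ker ↔ w ∈ (marked J').ofFree.ker) := by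
  -- The group for `Set.univ` maps onto all the others, so a single `u` represents the left
  -- component of `w` for every `J`.
  obtain ⟨u, hu⟩ := PresentedGroup.mk_surjective _ (FreeGroup.lift (gen Set.univ) w).left
  have key (J : Set ℕ) : w ∈ (marked J).ofFree.ker ↔
      PresentedGroup.mk (shiftArtinRels J) u = 1 ∧
        (FreeGroup.lift (gen Set.univ) w).right = 1 := by
    rw [mem_ker_ofFree_marked, ← map_lift_gen (Set.subset_univ J), SemidirectProduct.ext_iff,
      map_left, map_right, ← hu, ShiftArtin.map_mk, one_left, one_right]
  obtain ⟨N, hN⟩ := ShiftArtin.exists_mk_eq_one_iff u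
  exact ⟨N, fun J J' h => by rw [key, key, hN J J' h]⟩

theorem exists_sameRelations (n : ℕ) : ∃ N : ℕ, ∀ J J' : Set ℕ,
    (∀ i < N, i ∈ J ↔ i ∈ J') → MarkedGroup.SameRelations n (marked J) (marked J') := by
  choose N hN using exists_mem_ker_ofFree_iff
  -- The ball is finite, so the bounds `N w` have a common upper bound.
  have hfin : {w : FreeGroup (Fin 4) | w.norm ≤ n}.Finite :=
    (List.finite_length_le (Fin 4 × Bool) n).preimage FreeGroup.toWord_injective.injOn
  obtain ⟨M, hM⟩ := (hfin.image N).bddAbove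
  exact ⟨M, fun J J' h w hw => hN w J J' fun i hi =>
    h i (hi.trans_le (hM ⟨w, hw, rfl⟩))⟩

theorem continuous_marked : Continuous (fun x : ℕ → Bool => marked {n | x n = true}) := by
  refine continuous_def.2 fun U hU => isOpen_iff_mem_nhds.2 fun x hx => ?_
  obtain ⟨n, hn⟩ := hU _ hx
  obtain ⟨N, hN⟩ := exists_sameRelations n
  have hnhds : ∀ᶠ y : ℕ → Bool in nhds x, ∀ i ∈ Set.Iio N, y i = x i :=
    (Filter.eventually_all_finite (Set.finite_Iio N)).2 fun i _ =>
      (continuous_apply i).continuousAt.eventually_mem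
        ((isOpen_discrete {x i}).mem_nhds rfl)
  filter_upwards [hnhds] with y hy
  exact hn _ (hN _ _ fun i hi => by simp [hy i hi])

end ShiftArtinExt

theorem lemma1p9 :
    ∃ G : Set ℕ → MarkedGroup 4,
      (∀ J J' : Set ℕ, J ⊂ J' →
        ∃ φ : (G J').carrier →* (G J).carrier,
          MarkedGroup.IsMarkedHom (G J') (G J) φ ∧ Function.Surjective φ ∧
            ¬ IsAmenableGroup φ.ker) ∧
      Continuous (fun x : ℕ → Bool => G {n | x n = true}) :=
  ⟨ShiftArtinExt.marked, fun _ _ h => ⟨ShiftArtinExt.map h.subset,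
    ShiftArtinExt.map_gen h.subset, ShiftArtinExt.map_surjective h.subset,
    ShiftArtinExt.not_isAmenableGroup_ker_map h⟩, ShiftArtinExt.continuous_marked⟩
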